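/- Let $\delta>-1$. On a probability space let $\{BI_i(t):t\ge 0\}_{i\ge 1}$ be independent continuous-time Markov pure birth processes (with right-continuous paths) on the positive integers with transition rates $q_{j,j+1}=j+\delta$ (birth processes with immigration), started from $BI_1(0)=2$ and $BI_i(0)=1$ for $i\ge 2$. Let $0<\tau^{(i)}_1<\tau^{(i)}_2<\cdots$ be the jump times of $BI_i$. Define the branching times of Model A by $T^A_1=0$ and, for $n\ge 1$, $$T^A_{n+1}=\min\{T^A_i+\tau^{(i)}_k:\ k\ge 1,\ 1\le i\le n,\ T^A_i+\tau^{(i)}_k>T^A_n\},$$ and the branching times of Model B by $T^B_0=T^B_1=0$ and, for $n\ge 1$, $$T^B_{n+1}=\min\{T^B_{i-1}+\tau^{(i)}_k:\ k\ge 1,\ 1\le i\le n+1,\ T^B_{i-1}+\tau^{(i)}_k>T^B_n\}.$$ Then there are random variables $W_A\sim\mathrm{Exp}(1)$ and $W_B\sim\mathrm{Gamma}\left(\frac{3+2\delta}{2+\delta},1\right)$ (shape $\frac{3+2\delta}{2+\delta}$, rate $1$) such that, as $n\to\infty$, $$\frac{n}{e^{(2+\delta)T^A_n}}\longrightarrow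 W_A\quad\text{almost surely},\qquad \frac{n}{e^{(2+\delta)T^B_n}}\longrightarrow W_B\quad\text{almost surely}.$$ -/

import Mathlib

open MeasureTheory ProbabilityTheory Filter Topology
open scoped NNReal

namespace BranchingTimes

/-- The successive jump times `τ₀ = 0 < τ₁ < τ₂ < …` of a path `x : [0, ∞) → ℕ`:
`τ_{k+1} = inf {t ≥ τ_k : x t ≠ x τ_k}`. -/
noncomputable def jumpTime (x : ℝ≥0 → ℕ) : ℕ → ℝ≥0
  | 0 => 0
  | k + 1 => sInf {t : ℝ≥0 | jumpTime x k ≤ t ∧ x t ≠ x (jumpTime x k)}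

/-- `X` is a (continuous-time Markov) pure birth process started at `a` with transition rates
`q_{j,j+1} = q j`, in the jump chain / holding time form: the paths are right-continuous, the
chain goes up by one at every jump, and the successive holding times are independent, the one
in state `j` being exponential with rate `q j`. -/
structure IsBirthProcess {Ω : Type*} [MeasurableSpace Ω] (P : Measure Ω)
    (X : ℝ≥0 → Ω → ℕ) (a : ℕ) (q : ℕ → ℝ) : Prop where
  measurable : ∀ t, Measurable (X t)
  initial : ∀ᵐ ω ∂P, X 0 ω = a
  rightContinuous : ∀ᵐ ω ∂P, ∀ t : ℝ≥0,
    ContinuousWithinAt (fun s : ℝ≥0 => X s ω) (Set.Ici t) t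
  jumpChain : ∀ᵐ ω ∂P, ∀ k : ℕ, X (jumpTime (fun s => X s ω) k) ω = a + k
  holding_law : ∀ k : ℕ,
    HasLaw (fun ω => (jumpTime (fun s => X s ω) (k + 1) : ℝ) - jumpTime (fun s => X s ω) k)
      (expMeasure (q (a + k))) P
  holding_indep :
    iIndepFun (fun (k : ℕ) ω =>
      (jumpTime (fun s => X s ω) (k + 1) : ℝ) - jumpTime (fun s => X s ω) k) P

/-- `X` is a birth process with immigration (B.I. process) with unit lifetime parameter and
immigration parameter `δ`, started at `a`: its transition rates are `q_{j,j+1} = j + δ`. -/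
def IsBIProcess {Ω : Type*} [MeasurableSpace Ω] (P : Measure Ω)
    (X : ℝ≥0 → Ω → ℕ) (a : ℕ) (δ : ℝ) : Prop :=
  IsBirthProcess P X a (fun j => (j : ℝ) + δ)

/-- The branching times of Model A, for paths `x i` (`i = 1, 2, …`) with jump times `τ^{(i)}_k`:
`T₁ = 0`, and for `n ≥ 1`
`T_{n+1} = min {T_i + τ^{(i)}_k : k ≥ 1, 1 ≤ i ≤ n, T_i + τ^{(i)}_k > T_n}`.
The value at index `0` is a dummy. -/
noncomputable def branchTimeA (x : ℕ+ → ℝ≥0 → ℕ) : ℕ → ℝ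
  | 0 => 0
  | 1 => 0
  | n + 2 => sInf {t : ℝ | ∃ i : ℕ+, ∃ _ : (i : ℕ) ≤ n + 1, ∃ k : ℕ, 1 ≤ k ∧
      t = branchTimeA x (i : ℕ) + jumpTime (x i) k ∧ branchTimeA x (n + 1) < t}
  termination_by n => n
  decreasing_by all_goals omega

/-- The branching times of Model B, for paths `x i` (`i = 1, 2, …`) with jump times `τ^{(i)}_k`:
`T₀ = T₁ = 0`, and for `n ≥ 1`
`T_{n+1} = min {T_{i-1} + τ^{(i)}_k : k ≥ 1, 1 ≤ i ≤ n + 1, T_{i-1} + τ^{(i)}_k > T_n}`. -/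
noncomputable def branchTimeB (x : ℕ+ → ℝ≥0 → ℕ) : ℕ → ℝ
  | 0 => 0
  | 1 => 0
  | n + 2 => sInf {t : ℝ | ∃ i : ℕ+, ∃ _ : (i : ℕ) ≤ n + 2, ∃ k : ℕ, 1 ≤ k ∧
      t = branchTimeB x ((i : ℕ) - 1) + jumpTime (x i) k ∧ branchTimeB x (n + 1) < t}
  termination_by n => n
  decreasing_by
    · have := i.pos
      omega
    · omega

end BranchingTimes

/-! The holding times of all the processes are independent exponential clocks; the `k`-th clock of
individual `i` has rate `b i + k`, where `b i` is its initial jump rate. At any branching time each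
living individual has one clock running, and the first to ring gives the next branching time. By
lack of memory, the waiting time is exponential with the total rate, and it is independent of who
rings and of the residual clocks; these form a family of the same kind, with `b i` raised by one for
the winner (`clockMeasure_race`). Whoever wins, the total rate grows by `1` for the winner plus `1 +
δ` for the newborn. So the gaps are independent exponentials with deterministic rates `(2 + δ) * (s
+ j)` (`map_gapSeq_clockMeasure`), where `s = 1` in Model A and `s = (3 + 2δ)/(2 + δ)` in Model B. A
pathwise induction (`IsBranching.eq_sum`) shows that the branching times are the partial sums of
these gaps.

Put `c = 2 + δ` and let `d j` be the gaps. The products of `(s + j + 1)/(s + j) * exp (-c * d j)`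
form a nonnegative martingale, which gives almost sure convergence. The limit is identified through
logarithms: the characteristic function of `log n - c * ∑ d j` is a quotient of two terms of Euler's
sequence for the Gamma function, so it tends to `Γ(s + it)/Γ(s)`, the transform of the logarithm of
a gamma variable (`exists_tendsto_gapMeasure`). -/

namespace BranchingTimes

/-! ### Lack of memory for one and for finitely many exponential clocks. -/

lemma expMeasure_Iic_zero {r : ℝ} (hr : 0 < r) : expMeasure r (Set.Iic 0) = 0 := by
  have := isProbabilityMeasure_expMeasure hr
  have h := cdf_expMeasure_eq hr 0
  rw [cdf_eq_real] at h
  simp only [le_refl, if_true, mul_zero, neg_zero, Real.exp_zero, sub_self] at h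
  exact (measureReal_eq_zero_iff).1 h

lemma ae_pos_expMeasure {r : ℝ} (hr : 0 < r) : ∀ᵐ x ∂expMeasure r, 0 < x := by
  rw [ae_iff]
  simpa [Set.Iic] using expMeasure_Iic_zero hr

lemma expMeasure_apply (r : ℝ) {s : Set ℝ} (hs : MeasurableSet s) :
    expMeasure r s = ∫⁻ x in s, exponentialPDF r x := by
  rw [expMeasure, gammaMeasure, withDensity_apply _ hs]
  rfl

lemma measurable_exponentialPDF (r : ℝ) : Measurable (exponentialPDF r) :=
  (measurable_exponentialPDFReal r).ennreal_ofReal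

lemma lintegral_expMeasure (r : ℝ) {f : ℝ → ENNReal} (hf : Measurable f) :
    ∫⁻ x, f x ∂expMeasure r = ∫⁻ x, exponentialPDF r x * f x := by
  rw [expMeasure, gammaMeasure, lintegral_withDensity_eq_lintegral_mul _ _ hf]
  · rfl
  · exact measurable_exponentialPDF r

/-- The lack of memory of the exponential distribution. -/
lemma expMeasure_preimage_sub {r t : ℝ} (hr : 0 < r) (ht : 0 ≤ t) {s : Set ℝ}
    (hs : MeasurableSet s) :
    expMeasure r ((fun x => x - t) ⁻¹' (s ∩ Set.Ioi 0)) =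
      ENNReal.ofReal (Real.exp (-(r * t))) * expMeasure r s := by
  have hs' : expMeasure r s = expMeasure r (s ∩ Set.Ioi 0) := by
    refine measure_congr ?_
    filter_upwards [ae_pos_expMeasure hr] with x hx
    refine propext ⟨fun h => ⟨h, hx⟩, fun h => h.1⟩
  have hm : MeasurableSet (s ∩ Set.Ioi 0) := hs.inter measurableSet_Ioi
  rw [hs', expMeasure_apply r hm, expMeasure_apply r (hm.preimage (by fun_prop)),
    ← lintegral_const_mul _ (measurable_exponentialPDF r),
    ← lintegral_indicator (hm.preimage (by fun_prop)), ← lintegral_indicator hm,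
    ← lintegral_add_right_eq_self _ t]
  congr 1 with y
  by_cases hy : y ∈ s ∩ Set.Ioi 0
  · have hy0 : 0 < y := hy.2
    rw [Set.indicator_of_mem hy, Set.indicator_of_mem (by simpa using hy),
      exponentialPDF_of_nonneg hy0.le, exponentialPDF_of_nonneg (by positivity),
      ← ENNReal.ofReal_mul (Real.exp_nonneg _)]
    congr 1
    rw [mul_left_comm, ← Real.exp_add]
    ring_nf
  · rw [Set.indicator_of_notMem hy, Set.indicator_of_notMem (by simpa using hy)]

section Product

variable {ι : Type*} [DecidableEq ι]

/-- Subtract `t` from the coordinates in `L`. -/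
def shiftOn (L : Finset ι) (t : ℝ) (z : ι → ℝ) : ι → ℝ :=
  fun p => if p ∈ L then z p - t else z p

@[fun_prop]
lemma measurable_shiftOn (L : Finset ι) (t : ℝ) : Measurable (shiftOn L t) := by
  refine measurable_pi_lambda _ fun p => ?_
  by_cases hp : p ∈ L <;> simp only [shiftOn, hp, if_true, if_false] <;> fun_prop

/-- Lack of memory for finitely many coordinates of a family of independent exponential clocks. -/
lemma infinitePi_expMeasure_shiftOn {r : ι → ℝ} (hr : ∀ p, 0 < r p) (L : Finset ι) {t : ℝ}
    (ht : 0 ≤ t) {B : Set (ι → ℝ)} (hB : MeasurableSet B) :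
    Measure.infinitePi (fun p => expMeasure (r p))
      {z | (∀ l ∈ L, t < z l) ∧ shiftOn L t z ∈ B} =
      ENNReal.ofReal (Real.exp (-((∑ l ∈ L, r l) * t))) *
        Measure.infinitePi (fun p => expMeasure (r p)) B := by
  have hprob : ∀ p, IsProbabilityMeasure (expMeasure (r p)) :=
    fun p => isProbabilityMeasure_expMeasure (hr p)
  set μ := Measure.infinitePi (fun p => expMeasure (r p)) with hμ
  have hM : MeasurableSet {z : ι → ℝ | ∀ l ∈ L, t < z l} := by
    have : {z : ι → ℝ | ∀ l ∈ L, t < z l} = ⋂ l ∈ L, {z | t < z l} := by ext; simp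
    rw [this]
    exact Finset.measurableSet_biInter _ fun l _ => measurableSet_lt (by fun_prop) (by fun_prop)
  -- Equivalent form: the shifted clocks on the survival event, renormalised by the inverse survival
  -- probability, have law `μ`. This can be checked on boxes.
  have key : ENNReal.ofReal (Real.exp ((∑ l ∈ L, r l) * t)) •
      ((μ.restrict {z | ∀ l ∈ L, t < z l}).map (shiftOn L t)) = μ := by
    refine Measure.eq_infinitePi _ fun s T hT => ?_
    have hbox : MeasurableSet (Set.pi (s : Set ι) T) := .pi s.countable_toSet fun i _ => hT i
    rw [Measure.smul_apply, Measure.map_apply (by fun_prop) hbox,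
      Measure.restrict_apply (hbox.preimage (by fun_prop))]
    -- The preimage is again a box, now over `s ∪ L`: survival of a clock in `L` is encoded by
    -- intersecting its side with `Set.Ioi 0` before translating.
    have hset : shiftOn L t ⁻¹' Set.pi (s : Set ι) T ∩ {z | ∀ l ∈ L, t < z l} =
        Set.pi ((s ∪ L : Finset ι) : Set ι) (fun p => if p ∈ L then
          (fun x => x - t) ⁻¹' ((if p ∈ s then T p else Set.univ) ∩ Set.Ioi 0) else T p) := by
      ext z
      simp only [Set.mem_inter_iff, Set.mem_preimage, Set.mem_pi, Finset.mem_coe, Set.mem_ofPred_eq,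
        shiftOn, Finset.mem_union]
      constructor
      · rintro ⟨h1, h2⟩ p hp
        by_cases hL : p ∈ L
        · have := h2 p hL
          by_cases hps : p ∈ s
          · have h3 := h1 p hps
            simp_all
          · simp_all
        · have h3 := h1 p (by tauto)
          simp_all
      · intro h
        refine ⟨fun p hp => ?_, fun p hp => ?_⟩
        · have := h p (Or.inl hp)
          by_cases hL : p ∈ L <;> simp_all
        · have := h p (Or.inr hp)
          simp_all
    rw [hset, Measure.infinitePi_pi]
    · have h1 : ∀ p ∈ s ∪ L, expMeasure (r p) (if p ∈ L then
          (fun x => x - t) ⁻¹' ((if p ∈ s then T p else Set.univ) ∩ Set.Ioi 0) else T p) =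
          (if p ∈ L then ENNReal.ofReal (Real.exp (-(r p * t))) else 1) *
            (if p ∈ s then expMeasure (r p) (T p) else 1) := by
        intro p hp
        by_cases hL : p ∈ L
        · by_cases hps : p ∈ s
          · simp only [hL, hps, if_true, expMeasure_preimage_sub (hr p) ht (hT p)]
          · simp only [hL, hps, if_true, if_false,
              expMeasure_preimage_sub (hr p) ht MeasurableSet.univ, measure_univ]
        · have hps : p ∈ s := by simpa [hL] using hp
          simp [hL, hps]
      rw [Finset.prod_congr rfl h1, Finset.prod_mul_distrib, Finset.prod_ite_mem,
        Finset.prod_ite_mem, Finset.union_inter_cancel_right, Finset.union_inter_cancel_left,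
        ← ENNReal.ofReal_prod_of_nonneg (fun _ _ => Real.exp_nonneg _), ← Real.exp_sum, smul_eq_mul,
        ← mul_assoc, ← ENNReal.ofReal_mul (Real.exp_nonneg _), ← Real.exp_add,
        Finset.sum_neg_distrib, ← Finset.sum_mul]
      simp
    · intro p _
      split_ifs
      · exact ((hT p).inter measurableSet_Ioi).preimage (by fun_prop)
      · exact (MeasurableSet.univ.inter measurableSet_Ioi).preimage (by fun_prop)
      · exact hT p
  conv_rhs => rw [← key]
  rw [Measure.smul_apply, Measure.map_apply (by fun_prop) hB,
      Measure.restrict_apply (hB.preimage (by fun_prop)), smul_eq_mul, ← mul_assoc,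
      ← ENNReal.ofReal_mul (Real.exp_nonneg _), ← Real.exp_add]
  simp only [neg_add_cancel, Real.exp_zero, ENNReal.ofReal_one, one_mul]
  congr 1
  ext z
  simp [and_comm]

/-- Resampling one coordinate does not change a product measure. -/
lemma infinitePi_eq_map_update {X : ι → Type*} [∀ i, MeasurableSpace (X i)]
    (ν : ∀ i, Measure (X i)) [∀ i, IsProbabilityMeasure (ν i)] (i : ι) :
    ((ν i).prod (Measure.infinitePi ν)).map (fun q => Function.update q.2 i q.1) =
      Measure.infinitePi ν := by
  have hmeas : Measurable fun q : X i × (∀ i, X i) => Function.update q.2 i q.1 := by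
    refine measurable_pi_lambda _ fun j => ?_
    by_cases h : j = i
    · subst h; simpa using measurable_fst
    · simp only [Function.update_of_ne h]
      fun_prop
  refine Measure.eq_infinitePi _ fun s T hT => ?_
  rw [Measure.map_apply hmeas (.pi s.countable_toSet fun i _ => hT i)]
  have hset : (fun q : X i × (∀ i, X i) => Function.update q.2 i q.1) ⁻¹' Set.pi (s : Set ι) T =
      (if i ∈ s then T i else Set.univ) ×ˢ Set.pi ((s.erase i : Finset ι) : Set ι) T := by
    ext ⟨t, y⟩
    simp only [Set.mem_preimage, Set.mem_pi, Set.mem_prod, Finset.mem_coe, Finset.mem_erase]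
    constructor
    · intro h
      refine ⟨?_, fun j hj => by simpa [Function.update_of_ne hj.1] using h j hj.2⟩
      by_cases hi : i ∈ s
      · simpa [hi] using h i hi
      · simp [hi]
    · rintro ⟨h1, h2⟩ j hj
      by_cases h : j = i
      · subst h; simpa [hj] using h1
      · simpa [Function.update_of_ne h] using h2 j ⟨h, hj⟩
  rw [hset, Measure.prod_prod, Measure.infinitePi_pi _ fun j _ => hT j]
  by_cases hi : i ∈ s
  · simp [hi, Finset.mul_prod_erase s (fun j => ν j (T j)) hi]
  · simp [hi]

end Product

/-! ### One race between independent clocks. -/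

/-- Independent exponential clocks: the `k`-th clock of individual `i` has rate `b i + k`. -/
noncomputable def clockMeasure (b : ℕ → ℝ) : Measure (ℕ × ℕ → ℝ) :=
  Measure.infinitePi fun p => expMeasure (b p.1 + p.2)

lemma isProbabilityMeasure_clockMeasure {b : ℕ → ℝ} (hb : ∀ i, 0 < b i) :
    IsProbabilityMeasure (clockMeasure b) := by
  have : ∀ p : ℕ × ℕ, IsProbabilityMeasure (expMeasure (b p.1 + p.2)) := fun p =>
    isProbabilityMeasure_expMeasure (add_pos_of_pos_of_nonneg (hb _) (Nat.cast_nonneg _))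
  unfold clockMeasure
  infer_instance

/-- Run the first clocks of the individuals `j < m` until the one of `i` rings, and move on to the
next clock of `i`. -/
def advance (m i : ℕ) (x : ℕ × ℕ → ℝ) : ℕ × ℕ → ℝ :=
  fun p => if p.1 = i then x (i, p.2 + 1) else
    if p.1 < m ∧ p.2 = 0 then x p - x (i, 0) else x p

@[fun_prop]
lemma measurable_advance (m i : ℕ) : Measurable (advance m i) := by
  refine measurable_pi_lambda _ fun p => ?_
  unfold advance
  split_ifs <;> fun_prop

/-- The first clock of `i` is the first to ring among those of the individuals `j < m`. -/
def IsFirst (m i : ℕ) (x : ℕ × ℕ → ℝ) : Prop :=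
  ∀ j < m, j ≠ i → x (i, 0) < x (j, 0)

lemma measurableSet_isFirst (m i : ℕ) : MeasurableSet {x | IsFirst m i x} := by
  have : {x | IsFirst m i x} =
      ⋂ j ∈ (Finset.range m).erase i, {x : ℕ × ℕ → ℝ | x (i, 0) < x (j, 0)} := by
    ext x
    simp only [IsFirst, Set.mem_ofPred_eq, Set.mem_iInter, Finset.mem_erase, Finset.mem_range]
    exact ⟨fun h j hj => h j hj.2 hj.1, fun h j h1 h2 => h j ⟨h2, h1⟩⟩
  rw [this]
  exact Finset.measurableSet_biInter _ fun l _ => measurableSet_lt (by fun_prop) (by fun_prop)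

/-- The density of rate `r` times the survival probability `exp (-(s * t))` of the rivals is `r / (r
+ s)` times the density of rate `r + s`. This factorisation is why the ring time is independent of
the identity of the winner. -/
lemma setLIntegral_exp_neg_mul {r s : ℝ} (hr : 0 < r) (hs : 0 ≤ s) {A : Set ℝ}
    (hA : MeasurableSet A) :
    ∫⁻ t in A, ENNReal.ofReal (Real.exp (-(s * t))) ∂expMeasure r =
      expMeasure (r + s) A * ENNReal.ofReal (r / (r + s)) := by
  rw [expMeasure_apply _ hA, ← lintegral_indicator hA,
    lintegral_expMeasure r ((by fun_prop : Measurable fun t : ℝ =>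
      ENNReal.ofReal (Real.exp (-(s * t)))).indicator hA),
    ← lintegral_mul_const _ (measurable_exponentialPDF _), ← lintegral_indicator hA]
  congr 1 with t
  by_cases ht : t ∈ A
  · simp only [Set.indicator_of_mem ht]
    rcases lt_or_ge t 0 with h0 | h0
    · simp [exponentialPDF_of_neg h0]
    · rw [exponentialPDF_of_nonneg h0, exponentialPDF_of_nonneg h0,
        ← ENNReal.ofReal_mul (by positivity), ← ENNReal.ofReal_mul (by positivity)]
      congr 1
      have : r + s ≠ 0 := by positivity
      rw [mul_assoc, ← Real.exp_add]
      field_simp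
      ring_nf
  · simp [Set.indicator_of_notMem ht]

/-- A race between independent exponential clocks: the time of the first ring, the individual which
rings and the clocks seen from then on are independent, and the new clocks are again exponential. -/
theorem clockMeasure_race {b : ℕ → ℝ} (hb : ∀ i, 0 < b i) {m i : ℕ} (hi : i < m) {A : Set ℝ}
    (hA : MeasurableSet A) {B : Set (ℕ × ℕ → ℝ)} (hB : MeasurableSet B) :
    clockMeasure b {x | IsFirst m i x ∧ x (i, 0) ∈ A ∧ advance m i x ∈ B} =
      expMeasure (∑ j ∈ Finset.range m, b j) A *
        ENNReal.ofReal (b i / ∑ j ∈ Finset.range m, b j) *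
          clockMeasure (Function.update b i (b i + 1)) B := by
  have hpos : ∀ p : ℕ × ℕ, 0 < b p.1 + p.2 := fun p =>
    add_pos_of_pos_of_nonneg (hb _) (Nat.cast_nonneg _)
  have hprob : ∀ p : ℕ × ℕ, IsProbabilityMeasure (expMeasure (b p.1 + p.2)) :=
    fun p => isProbabilityMeasure_expMeasure (hpos p)
  have hE : MeasurableSet {x | IsFirst m i x ∧ x (i, 0) ∈ A ∧ advance m i x ∈ B} :=
    (measurableSet_isFirst m i).inter
      ((hA.preimage (by fun_prop)).inter (hB.preimage (by fun_prop)))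
  set b' := Function.update b i (b i + 1) with hb'
  have hb'pos : ∀ i, 0 < b' i := fun j => by
    by_cases h : j = i
    · subst h; simp only [hb', Function.update_self]; linarith [hb j]
    · simp only [hb', Function.update_of_ne h, hb j]
  have hpos' : ∀ p : ℕ × ℕ, 0 < b' p.1 + p.2 := fun p =>
    add_pos_of_pos_of_nonneg (hb'pos _) (Nat.cast_nonneg _)
  -- Relabelling that discards the clock `(i, 0)` and promotes the later clocks of `i`; this is what
  -- raises `b i` by one.
  set σ : ℕ × ℕ → ℕ × ℕ := fun p => if p.1 = i then (i, p.2 + 1) else p with hσ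
  have hσinj : Function.Injective σ := by
    rintro ⟨p1, p2⟩ ⟨q1, q2⟩ h
    simp only [hσ] at h
    split_ifs at h <;> simp_all
  have hmap : (clockMeasure b).map (fun y p => y (σ p)) = clockMeasure b' := by
    unfold clockMeasure
    rw [Measure.map_infinitePi_infinitePi_of_inj hσinj]
    congr 1 with p
    by_cases h : p.1 = i
    · simp only [hσ, h, if_true, hb', Function.update_self]
      push_cast
      ring_nf
    · simp only [hσ, h, if_false, hb', Function.update_of_ne h]
  set L : Finset (ℕ × ℕ) := (Finset.range m).erase i ×ˢ {0} with hL
  have hLmem : ∀ p : ℕ × ℕ, p ∈ L ↔ p.1 ≠ i ∧ p.1 < m ∧ p.2 = 0 := by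
    intro p
    simp only [hL, Finset.mem_product, Finset.mem_erase, Finset.mem_range,
      Finset.mem_singleton, and_assoc]
  have hsumL : ∑ l ∈ L, (b' l.1 + (l.2 : ℝ)) = ∑ j ∈ (Finset.range m).erase i, b j := by
    rw [hL, Finset.sum_product]
    refine Finset.sum_congr rfl fun j hj => ?_
    simp [hb', Function.update_of_ne (Finset.ne_of_mem_erase hj)]
  -- With the winning clock frozen at `t`, the race becomes the lack-of-memory event at time `t` for
  -- the relabelled clocks, which do not involve `(i, 0)`.
  have hslice : ∀ (t : ℝ) (y : ℕ × ℕ → ℝ),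
      (IsFirst m i (Function.update y (i, 0) t) ∧ Function.update y (i, 0) t (i, 0) ∈ A ∧
        advance m i (Function.update y (i, 0) t) ∈ B) ↔
      t ∈ A ∧ (fun p => y (σ p)) ∈ {z | (∀ l ∈ L, t < z l) ∧ shiftOn L t z ∈ B} := by
    intro t y
    have h1 : advance m i (Function.update y (i, 0) t) = shiftOn L t (fun p => y (σ p)) := by
      ext ⟨p1, p2⟩
      by_cases h : p1 = i
      · simp [advance, shiftOn, hLmem, hσ, h]
      · by_cases h2 : p1 < m ∧ p2 = 0
        · simp [advance, shiftOn, hLmem, hσ, h, h2]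
        · simp [advance, shiftOn, hLmem, hσ, h, h2]
    have h2 : IsFirst m i (Function.update y (i, 0) t) ↔ ∀ l ∈ L, t < y (σ l) := by
      simp only [IsFirst, hLmem, Function.update_self]
      constructor
      · rintro h ⟨j, k⟩ ⟨hj, hjm, rfl⟩
        simpa [hσ, hj] using h j hjm hj
      · intro h j hjm hj
        simpa [hσ, hj] using h (j, 0) ⟨hj, hjm, rfl⟩
    rw [h1, h2, Function.update_self]
    simp only [Set.mem_ofPred_eq]
    tauto
  have hmeasU : Measurable fun q : ℝ × (ℕ × ℕ → ℝ) => Function.update q.2 (i, 0) q.1 := by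
    refine measurable_pi_lambda _ fun j => ?_
    by_cases h : j = (i, 0)
    · subst h; simpa using measurable_fst
    · simp only [Function.update_of_ne h]
      fun_prop
  have hreset := infinitePi_eq_map_update (fun p : ℕ × ℕ => expMeasure (b p.1 + p.2)) (i, 0)
  have hZ : ∀ t, MeasurableSet {z : ℕ × ℕ → ℝ | (∀ l ∈ L, t < z l) ∧ shiftOn L t z ∈ B} := by
    intro t
    have : {z : ℕ × ℕ → ℝ | (∀ l ∈ L, t < z l) ∧ shiftOn L t z ∈ B} =
      (⋂ l ∈ L, {z | t < z l}) ∩ shiftOn L t ⁻¹' B := by ext; simp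
    rw [this]
    exact (Finset.measurableSet_biInter _ fun l _ =>
      measurableSet_lt (by fun_prop) (by fun_prop)).inter (hB.preimage (by fun_prop))
  -- Resampling the clock `(i, 0)` separates it from the others, so that Fubini applies.
  rw [show clockMeasure b = _ from hreset.symm, Measure.map_apply hmeasU hE,
    Measure.prod_apply (hE.preimage hmeasU)]
  have hrate : b i + ∑ j ∈ (Finset.range m).erase i, b j = ∑ j ∈ Finset.range m, b j :=
    Finset.add_sum_erase _ _ (Finset.mem_range.2 hi)
  rw [← hrate, ← setLIntegral_exp_neg_mul (hb i) (Finset.sum_nonneg fun j _ => (hb j).le) hA,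
    ← lintegral_mul_const _ (by fun_prop), ← lintegral_indicator hA]
  simp only [Nat.cast_zero, add_zero]
  refine lintegral_congr_ae ?_
  filter_upwards [ae_pos_expMeasure (hb i)] with t ht
  have hpre : Prod.mk t ⁻¹' ((fun q : ℝ × (ℕ × ℕ → ℝ) => Function.update q.2 (i, 0) q.1) ⁻¹'
      {x | IsFirst m i x ∧ x (i, 0) ∈ A ∧ advance m i x ∈ B}) =
      {y | t ∈ A ∧ (fun p => y (σ p)) ∈
        {z | (∀ l ∈ L, t < z l) ∧ shiftOn L t z ∈ B}} := by
    ext y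
    exact hslice t y
  rw [hpre]
  by_cases htA : t ∈ A
  · rw [Set.indicator_of_mem htA]
    simp only [htA, true_and]
    change clockMeasure b ((fun y p => y (σ p)) ⁻¹' _) = _
    rw [← Measure.map_apply (by fun_prop) (hZ t), hmap]
    unfold clockMeasure
    rw [infinitePi_expMeasure_shiftOn hpos' L ht.le hB, hsumL]
  · simp [htA]

/-! ### Iterated races and the law of the gaps. -/

/-- The individual `i < m` whose first clock rings first (the smallest one in case of a tie). -/
noncomputable def winner : ℕ → (ℕ × ℕ → ℝ) → ℕ
  | 0, _ => 0
  | m + 1, x => if x (winner m x, 0) ≤ x (m, 0) then winner m x else m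

lemma winner_le (m : ℕ) (x : ℕ × ℕ → ℝ) : ∀ j < m, x (winner m x, 0) ≤ x (j, 0) := by
  induction m with
  | zero => simp
  | succ m ih =>
    intro j hj
    rw [winner]
    rcases Nat.lt_succ_iff_lt_or_eq.1 hj with h | rfl
    · split_ifs with hx
      · exact ih j h
      · exact (not_le.1 hx).le.trans (ih j h)
    · split_ifs with hx
      · exact hx
      · exact le_rfl

lemma winner_lt {m : ℕ} (hm : 0 < m) (x : ℕ × ℕ → ℝ) : winner m x < m := by
  induction m with
  | zero => exact absurd hm (lt_irrefl 0)
  | succ m ih =>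
    rw [winner]
    split_ifs with hx
    · rcases Nat.eq_zero_or_pos m with rfl | h
      · simp [winner]
      · exact (ih h).trans (Nat.lt_succ_self m)
    · exact Nat.lt_succ_self m

lemma IsFirst.winner_eq {m i : ℕ} (hi : i < m) {x : ℕ × ℕ → ℝ} (h : IsFirst m i x) :
    winner m x = i := by
  by_contra hne
  exact absurd (winner_le m x i hi)
    (not_le.2 (h _ (winner_lt (Nat.zero_lt_of_lt hi) x) hne))

lemma measurable_comp_winner {β : Type*} [MeasurableSpace β] {g : (ℕ × ℕ → ℝ) → ℕ}
    (hg : Measurable g) {f : ℕ → (ℕ × ℕ → ℝ) → β} (hf : ∀ i, Measurable (f i)) :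
    Measurable fun x => f (g x) x := by
  have : Measurable fun q : ℕ × (ℕ × ℕ → ℝ) => f q.1 q.2 :=
    measurable_from_prod_countable_right hf
  exact this.comp (hg.prodMk measurable_id)

lemma measurable_winner (m : ℕ) : Measurable (winner m) := by
  induction m with
  | zero => exact measurable_const
  | succ m ih =>
    refine Measurable.ite (measurableSet_le ?_ (by fun_prop)) ih measurable_const
    exact measurable_comp_winner ih (f := fun i x => x (i, 0)) fun i => by fun_prop

/-- The time of the first ring among the first clocks of the individuals `j < m`. -/
noncomputable def gap (m : ℕ) (x : ℕ × ℕ → ℝ) : ℝ := x (winner m x, 0)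

/-- The clocks as seen from the time of the first ring. -/
noncomputable def step (m : ℕ) (x : ℕ × ℕ → ℝ) : ℕ × ℕ → ℝ := advance m (winner m x) x

/-- The clocks after `n` rings, when the number of individuals is `m` at the beginning and goes up
by one at each ring. -/
noncomputable def stepIter (m : ℕ) (x : ℕ × ℕ → ℝ) : ℕ → ℕ × ℕ → ℝ
  | 0 => x
  | n + 1 => step (m + n) (stepIter m x n)

/-- The times between consecutive rings. -/
noncomputable def gapSeq (m : ℕ) (x : ℕ × ℕ → ℝ) (n : ℕ) : ℝ := gap (m + n) (stepIter m x n)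

@[fun_prop]
lemma measurable_gap (m : ℕ) : Measurable (gap m) :=
  measurable_comp_winner (measurable_winner m) (f := fun i x => x (i, 0)) fun i => by fun_prop

@[fun_prop]
lemma measurable_step (m : ℕ) : Measurable (step m) :=
  measurable_comp_winner (measurable_winner m) (f := advance m) (measurable_advance m)

lemma measurable_stepIter (m n : ℕ) : Measurable fun x => stepIter m x n := by
  induction n with
  | zero => exact measurable_id
  | succ n ih => exact (measurable_step _).comp ih

lemma measurable_gapSeq (m : ℕ) : Measurable (gapSeq m) :=
  measurable_pi_lambda _ fun n => (measurable_gap _).comp (measurable_stepIter m n)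

lemma stepIter_succ' (m : ℕ) (x : ℕ × ℕ → ℝ) (n : ℕ) :
    stepIter m x (n + 1) = stepIter (m + 1) (step m x) n := by
  induction n with
  | zero => rfl
  | succ n ih => rw [stepIter, ih, stepIter, add_right_comm, add_assoc]

lemma gapSeq_succ (m : ℕ) (x : ℕ × ℕ → ℝ) (n : ℕ) :
    gapSeq m x (n + 1) = gapSeq (m + 1) (step m x) n := by
  rw [gapSeq, gapSeq, stepIter_succ', add_right_comm, add_assoc]

lemma measure_biUnion_isFirst (μ : Measure (ℕ × ℕ → ℝ)) (m : ℕ) {E : ℕ → Set (ℕ × ℕ → ℝ)}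
    (hE : ∀ i, MeasurableSet (E i)) (hfirst : ∀ i, E i ⊆ {x | IsFirst m i x}) :
    μ (⋃ i ∈ Finset.range m, E i) = ∑ i ∈ Finset.range m, μ (E i) := by
  refine measure_biUnion_finset (fun i hi j hj hij => ?_) fun i _ => hE i
  refine Set.disjoint_left.2 fun x hxi hxj => hij ?_
  rw [← IsFirst.winner_eq (Finset.mem_range.1 hi) (hfirst i hxi),
    ← IsFirst.winner_eq (Finset.mem_range.1 hj) (hfirst j hxj)]

lemma sum_ofReal_div_sum {b : ℕ → ℝ} (hb : ∀ i, 0 < b i) {m : ℕ} (hm : 0 < m) :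
    ∑ i ∈ Finset.range m, ENNReal.ofReal (b i / ∑ j ∈ Finset.range m, b j) = 1 := by
  have hR : 0 < ∑ j ∈ Finset.range m, b j :=
    Finset.sum_pos (fun i _ => hb i) (Finset.nonempty_range_iff.2 hm.ne')
  rw [← ENNReal.ofReal_sum_of_nonneg fun i _ => div_nonneg (hb i).le hR.le, ← Finset.sum_div,
    div_self hR.ne', ENNReal.ofReal_one]

lemma update_pos {b : ℕ → ℝ} (hb : ∀ i, 0 < b i) (i : ℕ) :
    ∀ j, 0 < Function.update b i (b i + 1) j := fun j => by
  by_cases h : j = i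
  · subst h; simp only [Function.update_self]; linarith [hb j]
  · simp only [Function.update_of_ne h, hb j]

/-- The events that `i` rings strictly first are disjoint, and their probabilities `b i / ∑ b j`
already add up to one, which leaves no mass for ties. -/
lemma ae_exists_isFirst {b : ℕ → ℝ} (hb : ∀ i, 0 < b i) {m : ℕ} (hm : 0 < m) :
    ∀ᵐ x ∂clockMeasure b, ∃ i < m, IsFirst m i x := by
  have := isProbabilityMeasure_clockMeasure hb
  have := isProbabilityMeasure_expMeasure
    (Finset.sum_pos (fun i _ => hb i) (Finset.nonempty_range_iff.2 hm.ne'))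
  have hset : {x | ∃ i < m, IsFirst m i x} = ⋃ i ∈ Finset.range m, {x | IsFirst m i x} := by
    ext; simp
  have hms : MeasurableSet {x | ∃ i < m, IsFirst m i x} := by
    rw [hset]
    exact Finset.measurableSet_biUnion _ fun i _ => measurableSet_isFirst m i
  refine (mem_ae_iff_prob_eq_one hms).2 ?_
  rw [hset, measure_biUnion_isFirst _ m (measurableSet_isFirst m) fun _ => subset_rfl,
    ← sum_ofReal_div_sum hb hm]
  refine Finset.sum_congr rfl fun i hi => ?_
  have h := clockMeasure_race hb (Finset.mem_range.1 hi) MeasurableSet.univ MeasurableSet.univ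
  have := isProbabilityMeasure_clockMeasure (update_pos hb i)
  simpa using h

/-- The first gap is exponential, and it is independent of those events about the new clocks which
do not depend on the individual that rings. -/
theorem clockMeasure_step {b : ℕ → ℝ} (hb : ∀ i, 0 < b i) {m : ℕ} (hm : 0 < m) {A : Set ℝ}
    (hA : MeasurableSet A) {B : Set (ℕ × ℕ → ℝ)} (hB : MeasurableSet B) {c : ENNReal}
    (hc : ∀ i < m, clockMeasure (Function.update b i (b i + 1)) B = c) :
    clockMeasure b {x | gap m x ∈ A ∧ step m x ∈ B} =
      expMeasure (∑ j ∈ Finset.range m, b j) A * c := by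
  set E : ℕ → Set (ℕ × ℕ → ℝ) :=
    fun i => {x | IsFirst m i x ∧ x (i, 0) ∈ A ∧ advance m i x ∈ B} with hE
  have hms : ∀ i, MeasurableSet (E i) := fun i => (measurableSet_isFirst m i).inter
      ((hA.preimage (by fun_prop)).inter (hB.preimage (by fun_prop)))
  have hset : clockMeasure b {x | gap m x ∈ A ∧ step m x ∈ B} =
      clockMeasure b (⋃ i ∈ Finset.range m, E i) := by
    refine measure_congr ?_
    filter_upwards [ae_exists_isFirst hb hm] with x hx
    obtain ⟨i, him, hi⟩ := hx
    refine propext ⟨fun h => ?_, fun h => ?_⟩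
    · refine Set.mem_biUnion (x := i) (Finset.mem_coe.2 (Finset.mem_range.2 him)) ?_
      obtain ⟨h1, h2⟩ := h
      rw [gap, hi.winner_eq him] at h1
      rw [step, hi.winner_eq him] at h2
      exact ⟨hi, h1, h2⟩
    · obtain ⟨j, hj, h0, h1, h2⟩ := Set.mem_iUnion₂.1 h
      refine ⟨?_, ?_⟩
      · rwa [gap, h0.winner_eq (Finset.mem_range.1 hj)]
      · rwa [step, h0.winner_eq (Finset.mem_range.1 hj)]
  rw [hset, measure_biUnion_isFirst _ m hms fun i x hx => hx.1]
  have hsum : ∀ i ∈ Finset.range m, clockMeasure b (E i) =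
      ENNReal.ofReal (b i / ∑ j ∈ Finset.range m, b j) *
        (expMeasure (∑ j ∈ Finset.range m, b j) A * c) := fun i hi => by
    rw [hE, clockMeasure_race hb (Finset.mem_range.1 hi) hA hB, hc i (Finset.mem_range.1 hi)]
    ring
  rw [Finset.sum_congr rfl hsum, ← Finset.sum_mul, sum_ofReal_div_sum hb hm, one_mul]

lemma sum_update_add_one (b : ℕ → ℝ) {i n : ℕ} (hi : i < n) :
    ∑ j ∈ Finset.range n, Function.update b i (b i + 1) j = ∑ j ∈ Finset.range n, b j + 1 := by
  rw [Finset.sum_update_of_mem (Finset.mem_range.2 hi), Finset.sdiff_singleton_eq_erase,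
    ← Finset.add_sum_erase _ b (Finset.mem_range.2 hi)]
  ring

lemma clockMeasure_gapSeq_mem {b : ℕ → ℝ} (hb : ∀ i, 0 < b i) {m : ℕ} (hm : 0 < m) (n : ℕ)
    {A : ℕ → Set ℝ} (hA : ∀ j, MeasurableSet (A j)) :
    clockMeasure b {x | ∀ j < n, gapSeq m x j ∈ A j} =
      ∏ j ∈ Finset.range n, expMeasure (∑ i ∈ Finset.range (m + j), b i + j) (A j) := by
  induction n generalizing m b A with
  | zero =>
    have := isProbabilityMeasure_clockMeasure hb
    simp
  | succ n ih =>
    have hset : {x | ∀ j < n + 1, gapSeq m x j ∈ A j} = {x | gap m x ∈ A 0 ∧ step m x ∈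
        {y | ∀ j < n, gapSeq (m + 1) y j ∈ A (j + 1)}} := by
      ext x
      simp only [Set.mem_ofPred_eq]
      constructor
      · intro h
        exact ⟨h 0 (Nat.succ_pos n), fun j hj => by
          rw [← gapSeq_succ]; exact h (j + 1) (Nat.succ_lt_succ hj)⟩
      · rintro ⟨h0, h1⟩ (_ | j) hj
        · exact h0
        · rw [gapSeq_succ]; exact h1 j (Nat.lt_of_succ_lt_succ hj)
    have hB : MeasurableSet {y | ∀ j < n, gapSeq (m + 1) y j ∈ A (j + 1)} := by
      have : {y | ∀ j < n, gapSeq (m + 1) y j ∈ A (j + 1)} =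
          ⋂ j ∈ Finset.range n, {y | gapSeq (m + 1) y j ∈ A (j + 1)} := by ext; simp
      rw [this]
      exact Finset.measurableSet_biInter _ fun j _ =>
        (measurable_pi_iff.1 (measurable_gapSeq (m + 1)) j) (hA (j + 1))
    rw [hset, clockMeasure_step hb hm (hA 0) hB (c := ∏ j ∈ Finset.range n,
      expMeasure (∑ i ∈ Finset.range (m + 1 + j), b i + 1 + j) (A (j + 1))), Finset.prod_range_succ',
      mul_comm]
    · congr 1
      · refine Finset.prod_congr rfl fun j _ => ?_
        rw [add_right_comm m 1 j, add_assoc m j 1]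
        push_cast
        ring_nf
      · simp
    -- The winner enters the later rates only through the sum of the `b j`, which rises by one
    -- whoever wins; hence the constant `c` is the same for all `i`.
    · intro i hi
      rw [ih (update_pos hb i) (Nat.succ_pos m) fun j => hA (j + 1)]
      refine Finset.prod_congr rfl fun j _ => ?_
      rw [sum_update_add_one b (by omega)]

/-- The times between consecutive rings are independent exponential variables, whose rates grow with
the number of rings and of individuals. -/
theorem map_gapSeq_clockMeasure {b : ℕ → ℝ} (hb : ∀ i, 0 < b i) {m : ℕ} (hm : 0 < m) :
    (clockMeasure b).map (gapSeq m) =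
      Measure.infinitePi fun j : ℕ => expMeasure (∑ i ∈ Finset.range (m + j), b i + j) := by
  have hρ : ∀ j : ℕ, 0 < ∑ i ∈ Finset.range (m + j), b i + j := fun j =>
    add_pos_of_pos_of_nonneg (Finset.sum_pos (fun i _ => hb i)
      (Finset.nonempty_range_iff.2 (by omega))) (Nat.cast_nonneg j)
  have := fun j => isProbabilityMeasure_expMeasure (hρ j)
  refine Measure.eq_infinitePi _ fun s T hT => ?_
  rw [Measure.map_apply (measurable_gapSeq m) (.pi s.countable_toSet fun i _ => hT i)]
  obtain ⟨n, hn⟩ := s.exists_nat_subset_range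
  have hset : gapSeq m ⁻¹' Set.pi (s : Set ℕ) T =
      {x | ∀ j < n, gapSeq m x j ∈ if j ∈ s then T j else Set.univ} := by
    ext x
    simp only [Set.mem_preimage, Set.mem_pi, Finset.mem_coe, Set.mem_ofPred_eq]
    constructor
    · intro h j _
      split_ifs with hj
      · exact h j hj
      · trivial
    · intro h j hj
      simpa [hj] using h j (Finset.mem_range.1 (hn hj))
  rw [hset, clockMeasure_gapSeq_mem hb hm n fun j => by split_ifs <;> simp [hT j]]
  rw [← Finset.prod_subset hn]
  · exact Finset.prod_congr rfl fun j hj => by rw [if_pos hj]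
  · intro j _ hj
    rw [if_neg hj, measure_univ]

/-- Almost surely no two clocks ever ring at the same time. -/
theorem ae_stepIter_pos {b : ℕ → ℝ} (hb : ∀ i, 0 < b i) {m : ℕ} (hm : 0 < m) :
    ∀ᵐ x ∂clockMeasure b, ∀ n p, 0 < stepIter m x n p := by
  rw [ae_all_iff]
  intro n
  induction n generalizing m b with
  | zero =>
    rw [ae_all_iff]
    intro p
    have hpos : ∀ p : ℕ × ℕ, 0 < b p.1 + p.2 := fun p =>
      add_pos_of_pos_of_nonneg (hb _) (Nat.cast_nonneg _)
    have := fun p => isProbabilityMeasure_expMeasure (hpos p)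
    have h := ae_pos_expMeasure (hpos p)
    rw [← Measure.infinitePi_map_eval (fun p : ℕ × ℕ => expMeasure (b p.1 + p.2)) p] at h
    exact ae_of_ae_map (measurable_pi_apply p).aemeasurable h
  | succ n ih =>
    have := isProbabilityMeasure_clockMeasure hb
    have := isProbabilityMeasure_expMeasure
      (Finset.sum_pos (fun i _ => hb i) (Finset.nonempty_range_iff.2 hm.ne'))
    have hB : MeasurableSet {y | ∀ p, 0 < stepIter (m + 1) y n p} := by
      rw [Set.ofPred_forall]
      exact MeasurableSet.iInter fun p => measurableSet_lt measurable_const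
        (measurable_pi_iff.1 (measurable_stepIter (m + 1) n) p)
    have h := clockMeasure_step hb hm MeasurableSet.univ hB (c := 1) fun i _ => by
      have := isProbabilityMeasure_clockMeasure (update_pos hb i)
      exact (mem_ae_iff_prob_eq_one hB).1 (ih (update_pos hb i) (Nat.succ_pos m))
    simp only [Set.mem_univ, true_and, measure_univ, mul_one] at h
    have h' := (mem_ae_iff_prob_eq_one (hB.preimage (measurable_step m))).2 h
    filter_upwards [h'] with x hx p
    rw [stepIter_succ']
    exact hx p

/-! ### Pathwise identification of the branching times with the iterated race. -/

/-- `S 0 ≤ S 1 ≤ …` are the branching times driven by the holding times `x`, when there are `m`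
individuals at time `S 0 = 0` and one more is born at each branching time. -/
structure IsBranching (m : ℕ) (x : ℕ × ℕ → ℝ) (S : ℕ → ℝ) : Prop where
  zero : S 0 = 0
  -- Truncated subtraction makes `S (i + 1 - m)` a birth time for everyone: it is `S 0` for the `m`
  -- founders and `S (n + 1)` for individual `m + n`.
  succ : ∀ n, S (n + 1) = sInf {t | ∃ i < m + n, ∃ k, 1 ≤ k ∧
    t = S (i + 1 - m) + ∑ l ∈ Finset.range k, x (i, l) ∧ S n < t}

/-- At the `n`-th branching time, the clocks `y` are what remains of the holding times `x`: the
individual `i` has made `c` jumps, and its next jumps occur at the rings of `y (i, ·)`. -/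
structure IsResidual (m : ℕ) (x : ℕ × ℕ → ℝ) (S : ℕ → ℝ) (n : ℕ) (y : ℕ × ℕ → ℝ) : Prop where
  alive : ∀ i < m + n, ∃ c, S (i + 1 - m) + ∑ l ∈ Finset.range c, x (i, l) ≤ S n ∧
    ∀ k, S (i + 1 - m) + ∑ l ∈ Finset.range (c + (k + 1)), x (i, l) =
      S n + ∑ l ∈ Finset.range (k + 1), y (i, l)
  unborn : ∀ i, m + n ≤ i → ∀ k, y (i, k) = x (i, k)

/-- The infimum is attained at the next ring of the winner. A candidate later than `S n` must come
after the `c` jumps already made, so it is at least one residual clock away from `S n`. -/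
lemma IsResidual.succ_eq {m : ℕ} (hm : 0 < m) {x y : ℕ × ℕ → ℝ} {S : ℕ → ℝ} {n : ℕ}
    (hS : IsBranching m x S) (hx : ∀ p, 0 < x p) (hy : ∀ p, 0 < y p) (h : IsResidual m x S n y) :
    S (n + 1) = S n + gap (m + n) y := by
  have hgap : 0 < gap (m + n) y := hy _
  rw [hS.succ]
  refine IsLeast.csInf_eq ⟨?_, ?_⟩
  · have hw := winner_lt (m := m + n) (by omega) y
    obtain ⟨c, -, hc⟩ := h.alive _ hw
    refine ⟨_, hw, c + 1, by omega, ?_, by linarith⟩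
    have := hc 0
    simp only [zero_add, Finset.sum_range_one] at this
    exact this.symm
  · rintro t ⟨i, hi, k, -, rfl, ht⟩
    obtain ⟨c, hc1, hc2⟩ := h.alive i hi
    have hck : c < k := by
      by_contra hkc
      have : ∑ l ∈ Finset.range k, x (i, l) ≤ ∑ l ∈ Finset.range c, x (i, l) :=
        Finset.sum_le_sum_of_subset_of_nonneg (Finset.range_subset_range.2 (not_lt.1 hkc))
          fun l _ _ => (hx _).le
      linarith
    obtain ⟨j, rfl⟩ := Nat.exists_eq_add_of_lt hck
    rw [add_assoc, hc2, Finset.sum_range_succ']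
    have h1 := winner_le (m + n) y i hi
    have h2 : 0 ≤ ∑ l ∈ Finset.range j, y (i, l + 1) := Finset.sum_nonneg fun l _ => (hy _).le
    have h3 : gap (m + n) y = y (winner (m + n) y, 0) := rfl
    linarith

lemma IsResidual.step {m : ℕ} (hm : 0 < m) {x y : ℕ × ℕ → ℝ} {S : ℕ → ℝ} {n : ℕ}
    (hgap : 0 ≤ gap (m + n) y)
    (h : IsResidual m x S n y) (hsucc : S (n + 1) = S n + gap (m + n) y) :
    IsResidual m x S (n + 1) (step (m + n) y) := by
  have hw := winner_lt (m := m + n) (by omega) y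
  refine ⟨fun i hi => ?_, fun i hi k => ?_⟩
  · rcases Nat.lt_succ_iff_lt_or_eq.1 (show i < m + n + 1 by omega) with hi' | rfl
    · obtain ⟨c, hc1, hc2⟩ := h.alive i hi'
      by_cases hiw : i = winner (m + n) y
      · refine ⟨c + 1, ?_, fun k => ?_⟩
        · have := hc2 0
          simp only [zero_add, Finset.sum_range_one] at this
          rw [this, hsucc, gap, hiw]
        · rw [add_assoc, add_comm 1, hc2, Finset.sum_range_succ', hsucc, gap, ← hiw]
          have : ∀ l, BranchingTimes.step (m + n) y (i, l) = y (i, l + 1) := fun l => by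
            simp [BranchingTimes.step, advance, ← hiw]
          simp only [this]
          ring
      · refine ⟨c, by linarith, fun k => ?_⟩
        rw [hc2, Finset.sum_range_succ', Finset.sum_range_succ', hsucc]
        have h0 : BranchingTimes.step (m + n) y (i, 0) = y (i, 0) - gap (m + n) y := by
          simp [BranchingTimes.step, advance, hiw, hi', gap]
        have h1 : ∀ l, BranchingTimes.step (m + n) y (i, l + 1) = y (i, l + 1) := fun l => by
          simp [BranchingTimes.step, advance, hiw]
        simp only [h0, h1]
        ring
    -- The newborn has made no jump; its birth time is `S (n + 1)` itself, and its clocks were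
    -- untouched by the race.
    · refine ⟨0, ?_, fun k => ?_⟩
      · rw [show m + n + 1 - m = n + 1 by omega]
        simp
      · rw [show m + n + 1 - m = n + 1 by omega, zero_add]
        congr 1
        refine Finset.sum_congr rfl fun l _ => ?_
        rw [← h.unborn _ le_rfl]
        simp [BranchingTimes.step, advance, hw.ne']
  · rw [← h.unborn i (by omega)]
    have h1 : i ≠ winner (m + n) y := by omega
    have h2 : ¬ i < m + n := by omega
    simp [BranchingTimes.step, advance, h1, h2]

/-- If no two clocks ring at the same time, the differences of the branching times are the times
between consecutive rings. -/
theorem IsBranching.succ_eq {m : ℕ} (hm : 0 < m) {x : ℕ × ℕ → ℝ} {S : ℕ → ℝ}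
    (hS : IsBranching m x S) (hpos : ∀ n p, 0 < stepIter m x n p) (n : ℕ) :
    S (n + 1) = S n + gapSeq m x n := by
  have hres : ∀ n, IsResidual m x S n (stepIter m x n) := by
    intro n
    induction n with
    | zero =>
      refine ⟨fun i hi => ⟨0, ?_, fun k => ?_⟩, fun i _ k => rfl⟩
      · rw [show i + 1 - m = 0 by omega]
        simp
      · rw [show i + 1 - m = 0 by omega, zero_add]
        rfl
    | succ n ih => exact ih.step hm (hpos n _).le (ih.succ_eq hm hS (hpos 0) (hpos n))
  exact (hres n).succ_eq hm hS (hpos 0) (hpos n)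

theorem IsBranching.eq_sum {m : ℕ} (hm : 0 < m) {x : ℕ × ℕ → ℝ} {S : ℕ → ℝ}
    (hS : IsBranching m x S) (hpos : ∀ n p, 0 < stepIter m x n p) (n : ℕ) :
    S n = ∑ j ∈ Finset.range n, gapSeq m x j := by
  induction n with
  | zero => simp [hS.zero]
  | succ n ih => rw [hS.succ_eq hm hpos, Finset.sum_range_succ, ih]

/-! ### From paths to independent holding times. -/

/-- The first time at which the path is above `a`, computed from countably many values. -/
noncomputable def hittingTime (a : ℕ) (x : ℝ≥0 → ℕ) : ENNReal :=
  ⨅ n, if a ≤ x (TopologicalSpace.denseSeq ℝ≥0 n) then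
    (TopologicalSpace.denseSeq ℝ≥0 n : ENNReal) else ⊤

lemma measurable_hittingTime (a : ℕ) : Measurable (hittingTime a) := by
  refine Measurable.iInf fun n => Measurable.ite ?_ measurable_const measurable_const
  exact measurableSet_le measurable_const (measurable_pi_apply _)

section Path

variable {x : ℝ≥0 → ℕ} {a : ℕ}

lemma eq_jumpTime_of_mem_Ico {k : ℕ} {t : ℝ≥0} (h1 : jumpTime x k ≤ t)
    (h2 : t < jumpTime x (k + 1)) : x t = x (jumpTime x k) := by
  by_contra h
  rw [jumpTime] at h2
  exact notMem_of_lt_csInf h2 (OrderBot.bddBelow _) ⟨h1, h⟩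

lemma lt_of_lt_jumpTime (hchain : ∀ k, x (jumpTime x k) = a + k) {k : ℕ} {t : ℝ≥0}
    (ht : t < jumpTime x k) : x t < a + k := by
  induction k with
  | zero => simp [jumpTime] at ht
  | succ k ih =>
    rcases lt_or_ge t (jumpTime x k) with h | h
    · have := ih h
      omega
    · rw [eq_jumpTime_of_mem_Ico h ht, hchain]
      omega

/-- Before the jump the path is below `a + k`; just after it, right-continuity and discreteness keep
it equal to `a + k` on an interval that the dense sequence meets. The jump times thus agree with
measurable functions of the path, so independence of the paths passes to the holding times. -/
lemma hittingTime_eq_jumpTime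
    (hrc : ∀ t : ℝ≥0, ContinuousWithinAt (fun s : ℝ≥0 => x s) (Set.Ici t) t)
    (hchain : ∀ k, x (jumpTime x k) = a + k) (k : ℕ) :
    hittingTime (a + k) x = jumpTime x k := by
  refine le_antisymm ?_ ?_
  · refine ENNReal.le_of_forall_pos_le_add fun ε hε _ => ?_
    have hev : ∀ᶠ s in 𝓝[≥] (jumpTime x k), x s = x (jumpTime x k) := by
      have h := hrc (jumpTime x k)
      rw [ContinuousWithinAt, nhds_discrete, tendsto_pure] at h
      exact h
    obtain ⟨u, hu, hsub⟩ := mem_nhdsGE_iff_exists_Ico_subset.1 hev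
    have hlt : jumpTime x k < min u (jumpTime x k + ε) :=
      lt_min hu (lt_add_of_pos_right _ hε)
    obtain ⟨n, hn⟩ := (TopologicalSpace.denseRange_denseSeq ℝ≥0).exists_mem_open isOpen_Ioo
      (Set.nonempty_Ioo.2 hlt)
    have hx := hsub ⟨hn.1.le, hn.2.trans_le (min_le_left _ _)⟩
    refine (iInf_le _ n).trans ?_
    rw [if_pos (by rw [show x _ = _ from hx, hchain])]
    exact_mod_cast (hn.2.trans_le (min_le_right _ _)).le
  · refine le_iInf fun n => ?_
    split_ifs with h
    · refine ENNReal.coe_le_coe.2 (not_lt.1 fun hlt => ?_)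
      exact absurd (lt_of_lt_jumpTime hchain hlt) (not_lt.2 h)
    · exact le_top

end Path

/-- The holding times of a right-continuous path starting at `a` and going up by one at each
jump. -/
noncomputable def holdingTime (a : ℕ) (x : ℝ≥0 → ℕ) (k : ℕ) : ℝ :=
  (hittingTime (a + (k + 1)) x).toReal - (hittingTime (a + k) x).toReal

lemma measurable_holdingTime (a : ℕ) : Measurable (holdingTime a) :=
  measurable_pi_lambda _ fun _ =>
    (measurable_hittingTime _).ennreal_toReal.sub (measurable_hittingTime _).ennreal_toReal

section HoldingTimes

variable {Ω : Type*} [MeasurableSpace Ω] {P : Measure Ω}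

lemma IsBirthProcess.ae_holdingTime_eq {X : ℝ≥0 → Ω → ℕ} {a : ℕ} {q : ℕ → ℝ}
    (h : IsBirthProcess P X a q) : ∀ᵐ ω ∂P, ∀ k, holdingTime a (fun t => X t ω) k =
      (jumpTime (fun s => X s ω) (k + 1) : ℝ) - jumpTime (fun s => X s ω) k := by
  filter_upwards [h.rightContinuous, h.jumpChain] with ω h1 h2 k
  rw [holdingTime, hittingTime_eq_jumpTime h1 h2, hittingTime_eq_jumpTime h1 h2]
  rfl

lemma hasLaw_infinitePi_uncurry [IsProbabilityMeasure P] {H : ℕ → ℕ → Ω → ℝ}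
    {ν : ℕ → ℕ → Measure ℝ} (hmeas : ∀ i k, Measurable (H i k))
    (h1 : iIndepFun (fun i ω k => H i k ω) P) (h2 : ∀ i, iIndepFun (H i) P)
    (hlaw : ∀ i k, HasLaw (H i k) (ν i k) P) :
    HasLaw (fun ω (p : ℕ × ℕ) => H p.1 p.2 ω) (Measure.infinitePi fun p : ℕ × ℕ => ν p.1 p.2) P :=
  (iIndepFun_uncurry' hmeas h1 h2).hasLaw_infinitePi (fun p : ℕ × ℕ => hlaw p.1 p.2)
    (measurable_pi_lambda _ fun p : ℕ × ℕ => hmeas p.1 p.2).aemeasurable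

/-- The holding times of independent birth processes with immigration. -/
theorem hasLaw_holdingTimes [IsProbabilityMeasure P] {X : ℕ → ℝ≥0 → Ω → ℕ} {a : ℕ → ℕ} {δ : ℝ}
    (hX : ∀ i, IsBIProcess P (X i) (a i) δ)
    (hindep : iIndepFun (fun (i : ℕ) (ω : Ω) (t : ℝ≥0) => X i t ω) P) :
    HasLaw (fun ω (p : ℕ × ℕ) =>
      (jumpTime (fun s => X p.1 s ω) (p.2 + 1) : ℝ) - jumpTime (fun s => X p.1 s ω) p.2)
      (clockMeasure fun i => a i + δ) P := by
  have hmeas : ∀ i, Measurable fun ω => holdingTime (a i) (fun t => X i t ω) := fun i =>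
    (measurable_holdingTime (a i)).comp (measurable_pi_lambda _ (hX i).measurable)
  have hmeas' : ∀ i k, Measurable fun ω => holdingTime (a i) (fun t => X i t ω) k := fun i k =>
    measurable_pi_iff.1 (hmeas i) k
  have hae : ∀ i k, (fun ω => holdingTime (a i) (fun t => X i t ω) k) =ᵐ[P]
      fun ω => (jumpTime (fun s => X i s ω) (k + 1) : ℝ) - jumpTime (fun s => X i s ω) k :=
    fun i k => (hX i).ae_holdingTime_eq.mono fun ω h => h k
  have h1 : iIndepFun (fun i ω => holdingTime (a i) (fun t => X i t ω)) P :=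
    hindep.comp (fun i => holdingTime (a i)) fun i => measurable_holdingTime (a i)
  have h2 : ∀ i, iIndepFun (fun k ω => holdingTime (a i) (fun t => X i t ω) k) P := fun i =>
    (hX i).holding_indep.congr fun k => (hae i k).symm
  have h4 : HasLaw (fun ω (p : ℕ × ℕ) => holdingTime (a p.1) (fun t => X p.1 t ω) p.2)
      (clockMeasure fun i => a i + δ) P := by
    refine hasLaw_infinitePi_uncurry (H := fun i k ω => holdingTime (a i) (fun t => X i t ω) k)
      hmeas' h1 h2 (ν := fun i k => expMeasure (a i + δ + k)) fun i k => ?_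
    have h5 := ((hX i).holding_law k).congr (hae i k)
    rwa [show ((a i + k : ℕ) : ℝ) + δ = a i + δ + k by push_cast; ring] at h5
  have hall : ∀ᵐ ω ∂P, ∀ i k, holdingTime (a i) (fun t => X i t ω) k =
      (jumpTime (fun s => X i s ω) (k + 1) : ℝ) - jumpTime (fun s => X i s ω) k :=
    ae_all_iff.2 fun i => (hX i).ae_holdingTime_eq
  refine HasLaw.congr (μ := clockMeasure fun i => a i + δ) h4 ?_
  filter_upwards [hall] with ω hω
  ext p
  exact (hω p.1 p.2).symm

end HoldingTimes

/-! ### Products of independent factors of mean one. -/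

section ProductMartingale

variable {Ω : Type*} [MeasurableSpace Ω] {μ : Measure Ω} [IsProbabilityMeasure μ]

lemma integrable_prod_range_of_iIndepFun {Z : ℕ → Ω → ℝ} (hm : ∀ n, Measurable (Z n))
    (hind : iIndepFun Z μ) (hint : ∀ n, Integrable (Z n) μ) (hmean : ∀ n, ∫ ω, Z n ω ∂μ = 1)
    (n : ℕ) : Integrable (∏ j ∈ Finset.range n, Z j) μ ∧
      ∫ ω, (∏ j ∈ Finset.range n, Z j) ω ∂μ = 1 := by
  induction n with
  | zero => exact ⟨by rw [Finset.prod_range_zero]; exact integrable_const (1 : ℝ), by simp⟩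
  | succ n ih =>
    have h := hind.indepFun_prod_range_succ hm n
    rw [Finset.prod_range_succ]
    refine ⟨h.integrable_mul ih.1 (hint n), ?_⟩
    rw [h.integral_mul_eq_mul_integral ih.1.aestronglyMeasurable (hint n).aestronglyMeasurable,
      ih.2, hmean, one_mul]

/-- Products of independent nonnegative random variables of mean one converge almost surely. -/
theorem ae_exists_tendsto_prod_range {Z : ℕ → Ω → ℝ} (hm : ∀ n, Measurable (Z n))
    (hind : iIndepFun Z μ) (hnonneg : ∀ n ω, 0 ≤ Z n ω) (hint : ∀ n, Integrable (Z n) μ)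
    (hmean : ∀ n, ∫ ω, Z n ω ∂μ = 1) :
    ∀ᵐ ω ∂μ, ∃ l, Tendsto (fun n => ∏ j ∈ Finset.range n, Z j ω) atTop (𝓝 l) := by
  have hsm : ∀ n, StronglyMeasurable (Z n) := fun n => (hm n).stronglyMeasurable
  set ℱ := Filtration.natural Z hsm with hℱ
  set M : ℕ → Ω → ℝ := fun n => ∏ j ∈ Finset.range (n + 1), Z j with hM
  have hint' := integrable_prod_range_of_iIndepFun hm hind hint hmean
  have hadp : StronglyAdapted ℱ M := by
    intro n
    refine Finset.stronglyMeasurable_prod _ fun j hj => ?_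
    exact (Filtration.stronglyAdapted_natural hsm j).mono
      (ℱ.mono (Nat.lt_succ_iff.1 (Finset.mem_range.1 hj)))
  have hmart : Martingale M ℱ μ := by
    refine martingale_nat hadp (fun n => (hint' _).1) fun n => ?_
    have h1 : M (n + 1) = M n * Z (n + 1) := Finset.prod_range_succ _ _
    have h2 := condExp_mul_of_stronglyMeasurable_left (μ := μ) (hadp n)
      (h1 ▸ (hint' (n + 2)).1) (hint (n + 1))
    have h3 : μ[Z (n + 1) | ℱ n] =ᵐ[μ] fun _ => ∫ ω, Z (n + 1) ω ∂μ :=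
      condExp_indep_eq (hm (n + 1)).comap_le (ℱ.le n)
        (comap_measurable (Z (n + 1))).stronglyMeasurable
        (hind.indep_comap_natural_of_lt hsm (Nat.lt_succ_self n))
    rw [h1]
    filter_upwards [h2, h3] with ω h2 h3
    rw [h2, Pi.mul_apply, h3, hmean, mul_one]
  -- Nonnegativity turns the constant mean into a bound in `L¹`, as martingale convergence requires.
  have hbdd : ∀ n, eLpNorm (M n) 1 μ ≤ (1 : ℝ≥0) := by
    intro n
    have hn : ∀ ω, 0 ≤ M n ω := fun ω => by
      simp only [hM, Finset.prod_apply]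
      exact Finset.prod_nonneg fun j _ => hnonneg j ω
    rw [eLpNorm_one_eq_lintegral_enorm]
    have : ∀ ω, ‖M n ω‖ₑ = ENNReal.ofReal (M n ω) := fun ω => Real.enorm_of_nonneg (hn ω)
    simp only [this]
    rw [← ofReal_integral_eq_lintegral_ofReal (hint' _).1 (Eventually.of_forall hn), (hint' _).2]
    simp
  filter_upwards [hmart.submartingale.exists_ae_tendsto_of_bdd hbdd] with ω hω
  obtain ⟨l, hl⟩ := hω
  refine ⟨l, (tendsto_add_atTop_iff_nat 1).1 ?_⟩
  simpa only [hM, Finset.prod_apply] using hl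

end ProductMartingale

/-! ### Transforms of exponential and gamma laws. -/

lemma integral_gammaMeasure {a r : ℝ} (ha : 0 < a) (hr : 0 < r) (f : ℝ → ℂ) :
    ∫ x, f x ∂gammaMeasure a r = ∫ x in Set.Ioi (0 : ℝ),
      ((r ^ a / Real.Gamma a * x ^ (a - 1) * Real.exp (-(r * x)) : ℝ) : ℂ) * f x := by
  have hm : Measurable (gammaPDF a r) := (measurable_gammaPDFReal a r).ennreal_ofReal
  rw [gammaMeasure, integral_withDensity_eq_integral_toReal_smul hm (Eventually.of_forall fun _ =>
    ENNReal.ofReal_lt_top), ← integral_Ici_eq_integral_Ioi, ← integral_indicator measurableSet_Ici]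
  congr 1 with x
  by_cases hx : 0 ≤ x
  · rw [Set.indicator_of_mem (Set.mem_Ici.2 hx), gammaPDF_of_nonneg hx, ENNReal.toReal_ofReal
      (by have := Real.Gamma_pos_of_pos ha; positivity), Complex.real_smul]
  · rw [Set.indicator_of_notMem (by simpa using hx), gammaPDF_of_neg (not_le.1 hx)]
    simp

/-- A complex parameter serves twice: real values normalise the martingale, and imaginary ones give
characteristic functions. -/
lemma integral_cexp_expMeasure {r : ℝ} (hr : 0 < r) {z : ℂ} (hz : 0 ≤ z.re) :
    ∫ x : ℝ, Complex.exp (-z * x) ∂expMeasure r = r / (r + z) := by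
  rw [expMeasure, integral_gammaMeasure one_pos hr]
  have hre : (-((r : ℂ) + z)).re < 0 := by
    simp only [Complex.neg_re, Complex.add_re, Complex.ofReal_re]
    linarith
  have h := integral_exp_mul_complex_Ioi hre 0
  have h2 : ∀ x : ℝ, ((r ^ (1 : ℝ) / Real.Gamma 1 * x ^ ((1 : ℝ) - 1) * Real.exp (-(r * x)) : ℝ) : ℂ)
      * Complex.exp (-z * x) = r * Complex.exp (-((r : ℂ) + z) * x) := fun x => by
    simp only [Real.rpow_one, Real.Gamma_one, sub_self, Real.rpow_zero]
    push_cast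
    rw [div_one, mul_one, mul_assoc, ← Complex.exp_add]
    ring_nf
  simp only [h2]
  rw [integral_const_mul, h]
  simp only [Complex.ofReal_zero, mul_zero, Complex.exp_zero]
  rw [neg_div_neg_eq, mul_one_div]

lemma integral_exp_neg_expMeasure {r c : ℝ} (hr : 0 < r) (hc : 0 ≤ c) :
    ∫ x : ℝ, Real.exp (-(c * x)) ∂expMeasure r = r / (r + c) := by
  have h := integral_cexp_expMeasure hr (z := c) (by simpa using hc)
  have h2 : ∀ x : ℝ, Complex.exp (-(c : ℂ) * x) = ((Real.exp (-(c * x)) : ℝ) : ℂ) := fun x => by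
    push_cast
    ring_nf
  simp only [h2] at h
  rw [integral_complex_ofReal] at h
  exact_mod_cast h

/-- This is the moment of imaginary order `it` of the gamma law, read off from Euler's integral. -/
lemma charFun_map_log_gammaMeasure {s : ℝ} (hs : 0 < s) (t : ℝ) :
    charFun ((gammaMeasure s 1).map Real.log) t =
      Complex.Gamma (s + t * Complex.I) / Complex.Gamma s := by
  rw [charFun_apply_real, integral_map Real.measurable_log.aemeasurable (by fun_prop),
    integral_gammaMeasure hs one_pos, Complex.Gamma_eq_integral (s := s + t * Complex.I)
      (by simpa using hs), Complex.GammaIntegral,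
    div_eq_inv_mul (∫ x in Set.Ioi _, _) (Complex.Gamma s), ← integral_const_mul]
  refine setIntegral_congr_fun measurableSet_Ioi fun x hx => ?_
  have hx' : (x : ℂ) ≠ 0 := by exact_mod_cast (ne_of_gt hx)
  rw [show (s : ℂ) + t * Complex.I - 1 = ((s - 1 : ℝ) : ℂ) + t * Complex.I by push_cast; ring,
    Complex.cpow_add _ _ hx', ← Complex.ofReal_cpow (le_of_lt hx), Complex.cpow_def_of_ne_zero hx',
    ← Complex.ofReal_log (le_of_lt hx), Complex.Gamma_ofReal]
  push_cast
  simp only [Real.one_rpow, one_mul, Complex.ofReal_one]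
  rw [show (t : ℂ) * Real.log x * Complex.I = Real.log x * (t * Complex.I) by ring]
  ring

lemma tendsto_natCast_add_div_natCast_add (a b : ℝ) :
    Tendsto (fun n : ℕ => ((n : ℝ) + a) / (n + b)) atTop (𝓝 1) := by
  have h := (tendsto_natCast_atTop_atTop (R := ℝ))
  have h1 : Tendsto (fun n : ℕ => 1 + (a - b) / ((n : ℝ) + b)) atTop (𝓝 (1 + 0)) :=
    tendsto_const_nhds.add ((tendsto_atTop_add_const_right _ b h).const_div_atTop _)
  rw [add_zero] at h1
  refine h1.congr' ?_
  filter_upwards [(tendsto_atTop_add_const_right _ b h).eventually_gt_atTop 0] with n hn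
  field_simp
  ring

lemma prod_range_div_telescope {s : ℝ} (hs : 0 < s) (n : ℕ) :
    ∏ j ∈ Finset.range n, (s + j + 1) / (s + j) = (s + n) / s := by
  induction n with
  | zero => simp [hs.ne']
  | succ n ih =>
    rw [Finset.prod_range_succ, ih]
    have : s + n ≠ 0 := by positivity
    push_cast
    field_simp
    ring

/-! ### The limit of a linear birth process at its jump times. -/

section Limit

variable {c s : ℝ}

/-- The law of the gaps of a linear birth process. -/
noncomputable def gapMeasure (c s : ℝ) : Measure (ℕ → ℝ) :=
  Measure.infinitePi fun j : ℕ => expMeasure (c * (s + j))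

lemma isProbabilityMeasure_gap (hc : 0 < c) (hs : 0 < s) (j : ℕ) :
    IsProbabilityMeasure (expMeasure (c * (s + j))) :=
  isProbabilityMeasure_expMeasure (by positivity)

/-- Almost sure convergence of a linear birth process, seen at its jump times. -/
lemma ae_exists_tendsto_gapMeasure (hc : 0 < c) (hs : 0 < s) :
    ∀ᵐ d ∂gapMeasure c s, ∃ l, Tendsto
      (fun n : ℕ => n / Real.exp (c * ∑ j ∈ Finset.range n, d j)) atTop (𝓝 l) := by
  have := isProbabilityMeasure_gap hc hs
  have : IsProbabilityMeasure (gapMeasure c s) := by unfold gapMeasure; infer_instance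
  -- The prefactor is the inverse of `E[exp (-c * d j)] = (s + j)/(s + j + 1)`. The prefactors
  -- telescope to `(s + n)/s`, which is asymptotically `n / s`.
  set Z : ℕ → (ℕ → ℝ) → ℝ := fun j d => (s + j + 1) / (s + j) * Real.exp (-(c * d j)) with hZ
  have hind : iIndepFun Z (gapMeasure c s) :=
    iIndepFun_infinitePi (X := fun (j : ℕ) (x : ℝ) =>
      (s + j + 1) / (s + j) * Real.exp (-(c * x))) fun j => by fun_prop
  have hm : ∀ j, Measurable (Z j) := fun j => by fun_prop
  have hnonneg : ∀ j d, 0 ≤ Z j d := fun j d => by positivity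
  have hmean : ∀ j, ∫ d, Z j d ∂gapMeasure c s = 1 := fun j => by
    have h1 : ∫ d, Z j d ∂gapMeasure c s =
        ∫ x, (s + j + 1) / (s + j) * Real.exp (-(c * x)) ∂expMeasure (c * (s + j)) := by
      rw [← Measure.infinitePi_map_eval (fun j : ℕ => expMeasure (c * (s + j))) j,
        integral_map (measurable_pi_apply j).aemeasurable (by fun_prop)]
      rfl
    rw [h1, integral_const_mul, integral_exp_neg_expMeasure (by positivity) hc.le]
    have : s + j ≠ 0 := by positivity
    have : c * (s + j) + c ≠ 0 := by positivity
    field_simp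
  have hint : ∀ j, Integrable (Z j) (gapMeasure c s) := fun j =>
    -- A non-integrable function would have integral `0`, not `1`.
    Integrable.of_integral_ne_zero (by rw [hmean]; exact one_ne_zero)
  filter_upwards [ae_exists_tendsto_prod_range hm hind hnonneg hint hmean] with d hd
  obtain ⟨l, hl⟩ := hd
  have h := ((hl.const_mul s).mul (tendsto_natCast_add_div_natCast_add 0 s))
  refine ⟨s * l * 1, h.congr fun n => ?_⟩
  simp only [hZ]
  rw [Finset.prod_mul_distrib, prod_range_div_telescope hs, ← Real.exp_sum, Finset.sum_neg_distrib,
    ← Finset.mul_sum, Real.exp_neg, add_comm (n : ℝ) s]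
  have : s + n ≠ 0 := by positivity
  field_simp
  ring

/-- By independence the transform is `n ^ (it)` times the product of `(s + j)/(s + it + j)`. Taking
`n + 1` gaps matches the product over `0 ≤ j ≤ n` in `Complex.GammaSeq`; the factors `n !` and `n ^
s` cancel. -/
lemma charFun_map_gapMeasure (hc : 0 < c) (hs : 0 < s) {n : ℕ} (hn : n ≠ 0) (t : ℝ) :
    charFun ((gapMeasure c s).map
      fun d => Real.log n - c * ∑ j ∈ Finset.range (n + 1), d j) t =
      Complex.GammaSeq (s + t * Complex.I) n / Complex.GammaSeq s n := by
  have := isProbabilityMeasure_gap hc hs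
  have : IsProbabilityMeasure (gapMeasure c s) := by unfold gapMeasure; infer_instance
  have hn' : (n : ℂ) ≠ 0 := Nat.cast_ne_zero.2 hn
  rw [charFun_apply_real, integral_map (by fun_prop) (by fun_prop)]
  have h1 : ∀ d : ℕ → ℝ, Complex.exp
      (t * ((Real.log n - c * ∑ j ∈ Finset.range (n + 1), d j : ℝ) : ℂ) * Complex.I) =
      (n : ℂ) ^ (t * Complex.I) *
        ∏ j : Fin (n + 1), Complex.exp (-(t * c * Complex.I) * d j) := fun d => by
    rw [← Complex.exp_sum, Complex.cpow_def_of_ne_zero hn', ← Complex.exp_add,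
      ← Finset.mul_sum, ← Fin.sum_univ_eq_sum_range]
    push_cast
    ring_nf
  have hind : iIndepFun (fun (j : Fin (n + 1)) (d : ℕ → ℝ) => d j) (gapMeasure c s) :=
    iIndepFun.precomp Fin.val_injective
      (iIndepFun_infinitePi (X := fun (j : ℕ) (x : ℝ) => x) fun j => by fun_prop)
  simp only [h1]
  rw [integral_const_mul, hind.integral_fun_prod_comp
    (f := fun _ x => Complex.exp (-(t * c * Complex.I) * (x : ℝ)))
    (fun j => (measurable_pi_apply _).aemeasurable) (fun j => by fun_prop)]
  have h2 : ∀ j : ℕ, ∫ d, Complex.exp (-(t * c * Complex.I) * (d j : ℝ)) ∂gapMeasure c s =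
      (s + j) / (s + t * Complex.I + j) := fun j => by
    have h3 : ∫ d, Complex.exp (-(t * c * Complex.I) * (d j : ℝ)) ∂gapMeasure c s =
        ∫ x : ℝ, Complex.exp (-(t * c * Complex.I) * x) ∂expMeasure (c * (s + j)) := by
      rw [← Measure.infinitePi_map_eval (fun j : ℕ => expMeasure (c * (s + j))) j,
        integral_map (measurable_pi_apply j).aemeasurable (by fun_prop)]
      rfl
    rw [h3, integral_cexp_expMeasure (by positivity) (by simp)]
    have hc' : (c : ℂ) ≠ 0 := Complex.ofReal_ne_zero.2 hc.ne'
    push_cast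
    rw [show (c : ℂ) * (s + j) + t * c * Complex.I = c * (s + t * Complex.I + j) by ring,
      mul_div_mul_left _ _ hc']
  simp only [h2]
  rw [Fin.prod_univ_eq_prod_range (fun j : ℕ => ((s : ℂ) + j) / (s + t * Complex.I + j)) (n + 1),
    Finset.prod_div_distrib, Complex.GammaSeq, Complex.GammaSeq, Complex.cpow_add _ _ hn']
  have h4 : ∏ j ∈ Finset.range (n + 1), ((s : ℂ) + j) ≠ 0 :=
    Finset.prod_ne_zero_iff.2 fun j _ => by
      exact_mod_cast (by positivity : s + (j : ℝ) ≠ 0)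
  have h5 : ∏ j ∈ Finset.range (n + 1), ((s : ℂ) + t * Complex.I + j) ≠ 0 :=
    Finset.prod_ne_zero_iff.2 fun j _ h => by
      have h' := congrArg Complex.re h
      simp at h'
      have : 0 < s + (j : ℝ) := by positivity
      linarith
  have h6 : (n : ℂ) ^ (s : ℂ) ≠ 0 := by simp [Complex.cpow_eq_zero_iff, hn']
  have h7 : (n.factorial : ℂ) ≠ 0 := Nat.cast_ne_zero.2 n.factorial_ne_zero
  field_simp

lemma map_exp_map_log_gammaMeasure (s : ℝ) :
    ((gammaMeasure s 1).map Real.log).map Real.exp = gammaMeasure s 1 := by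
  rw [Measure.map_map Real.measurable_exp Real.measurable_log]
  conv_rhs => rw [← Measure.map_id (μ := gammaMeasure s 1)]
  refine Measure.map_congr ?_
  have h0 : gammaMeasure s 1 (Set.Iic 0) = 0 := by
    rw [gammaMeasure, withDensity_apply _ measurableSet_Iic,
      setLIntegral_congr Iio_ae_eq_Iic.symm]
    exact lintegral_gammaPDF_of_nonpos le_rfl
  have h : ∀ᵐ x ∂gammaMeasure s 1, 0 < x := by
    rw [ae_iff]
    simpa [Set.Iic] using h0
  filter_upwards [h] with x hx
  simp [Real.exp_log hx]

/-- The limit of a linear birth process, seen at its jump times, has a gamma distribution. -/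
theorem exists_tendsto_gapMeasure (hc : 0 < c) (hs : 0 < s) :
    ∃ W : (ℕ → ℝ) → ℝ, HasLaw W (gammaMeasure s 1) (gapMeasure c s) ∧
      ∀ᵐ d ∂gapMeasure c s, Tendsto
        (fun n : ℕ => n / Real.exp (c * ∑ j ∈ Finset.range n, d j)) atTop (𝓝 (W d)) := by
  have := isProbabilityMeasure_gap hc hs
  have : IsProbabilityMeasure (gapMeasure c s) := by unfold gapMeasure; infer_instance
  have := isProbabilityMeasure_gammaMeasure hs one_pos
  have hmeas : ∀ n : ℕ, Measurable fun d : ℕ → ℝ =>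
    n / Real.exp (c * ∑ j ∈ Finset.range n, d j) := fun n => by fun_prop
  obtain ⟨W, hW, hlim⟩ := measurable_limit_of_tendsto_metrizable_ae
    (fun n => (hmeas n).aemeasurable) (ae_exists_tendsto_gapMeasure hc hs)
  refine ⟨W, ⟨hW.aemeasurable, ?_⟩, hlim⟩
  set X : ℕ → (ℕ → ℝ) → ℝ :=
    fun n d => Real.log n - c * ∑ j ∈ Finset.range (n + 1), d j with hX
  have hXm : ∀ n, Measurable (X n) := fun n => by fun_prop
  have hdist : TendstoInDistribution X atTop Real.log (fun _ => gapMeasure c s)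
      (gammaMeasure s 1) := by
    refine ⟨fun n => (hXm n).aemeasurable, Real.measurable_log.aemeasurable, ?_⟩
    refine ProbabilityMeasure.tendsto_of_tendsto_charFun fun t => ?_
    have hlim : Tendsto (fun n : ℕ =>
        Complex.GammaSeq (s + t * Complex.I) n / Complex.GammaSeq s n) atTop
        (𝓝 (Complex.Gamma (s + t * Complex.I) / Complex.Gamma s)) := by
      refine (Complex.GammaSeq_tendsto_Gamma _).div (Complex.GammaSeq_tendsto_Gamma _) ?_
      exact Complex.Gamma_ne_zero_of_re_pos (by simpa using hs)
    rw [← charFun_map_log_gammaMeasure hs] at hlim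
    refine hlim.congr' ?_
    filter_upwards [eventually_ne_atTop 0] with n hn
    exact (charFun_map_gapMeasure hc hs hn t).symm
  have hdist' := hdist.continuous_comp Real.continuous_exp
  -- The same variables converge almost surely to `W`, up to the ratio `n / (n + 1)` caused by the
  -- extra gap; uniqueness of limits in law then gives the law of `W`.
  have hae : TendstoInDistribution (fun n => Real.exp ∘ X n) atTop W (fun _ => gapMeasure c s)
      (gapMeasure c s) := by
    refine tendstoInDistribution_of_ae_tendsto
      (fun n => (Real.measurable_exp.comp (hXm n)).aemeasurable) hW.aemeasurable ?_
    filter_upwards [hlim] with d hd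
    have h := ((tendsto_add_atTop_iff_nat 1).2 hd).mul (tendsto_natCast_add_div_natCast_add 0 1)
    rw [mul_one] at h
    refine h.congr' ?_
    filter_upwards [eventually_ne_atTop 0] with n hn
    have hn' : (0 : ℝ) < n := Nat.cast_pos.2 (Nat.pos_of_ne_zero hn)
    simp only [hX, Function.comp_apply]
    rw [Real.exp_sub, Real.exp_log hn']
    have : (n : ℝ) + 1 ≠ 0 := by positivity
    push_cast
    field_simp
    ring
  rw [tendstoInDistribution_unique _ hae hdist', ← Measure.map_map Real.measurable_exp
    Real.measurable_log, map_exp_map_log_gammaMeasure s]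

end Limit

/-! ### The two models as branching schemes, and the conclusion. -/

lemma sum_range_jumpTime_sub (x : ℝ≥0 → ℕ) (k : ℕ) :
    ∑ l ∈ Finset.range k, ((jumpTime x (l + 1) : ℝ) - jumpTime x l) = jumpTime x k := by
  rw [Finset.sum_range_sub fun l => (jumpTime x l : ℝ)]
  simp [jumpTime]

lemma isBranching_branchTimeA (x : ℕ+ → ℝ≥0 → ℕ) :
    IsBranching 1 (fun p : ℕ × ℕ =>
      (jumpTime (x p.1.succPNat) (p.2 + 1) : ℝ) - jumpTime (x p.1.succPNat) p.2)
      fun n => branchTimeA x (n + 1) := by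
  refine ⟨by simp [branchTimeA], fun n => ?_⟩
  rw [branchTimeA]
  congr 1 with t
  simp only [Set.mem_ofPred_eq, sum_range_jumpTime_sub, add_tsub_cancel_right]
  constructor
  · rintro ⟨i, hi, k, hk, rfl, ht⟩
    refine ⟨i.natPred, ?_, k, hk, ?_, ht⟩
    · have := i.natPred_add_one
      omega
    · rw [PNat.natPred_add_one, PNat.succPNat_natPred]
  · rintro ⟨i, hi, k, hk, rfl, ht⟩
    exact ⟨i.succPNat, by rw [Nat.succPNat_coe]; omega, k, hk, rfl, ht⟩

lemma isBranching_branchTimeB (x : ℕ+ → ℝ≥0 → ℕ) :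
    IsBranching 2 (fun p : ℕ × ℕ =>
      (jumpTime (x p.1.succPNat) (p.2 + 1) : ℝ) - jumpTime (x p.1.succPNat) p.2)
      fun n => branchTimeB x (n + 1) := by
  -- For `i = 0` truncation yields `T₁` where the model has `T₀`; both vanish.
  have hbirth : ∀ i, branchTimeB x (i + 1 - 2 + 1) = branchTimeB x i := by
    rintro (_ | i)
    · simp [branchTimeB]
    · congr 1
  refine ⟨by simp [branchTimeB], fun n => ?_⟩
  rw [branchTimeB]
  congr 1 with t
  simp only [Set.mem_ofPred_eq, sum_range_jumpTime_sub, hbirth]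
  constructor
  · rintro ⟨i, hi, k, hk, rfl, ht⟩
    refine ⟨i.natPred, ?_, k, hk, ?_, ht⟩
    · have := i.natPred_add_one
      omega
    · rw [PNat.succPNat_natPred]
      rfl
  · rintro ⟨i, hi, k, hk, rfl, ht⟩
    exact ⟨i.succPNat, by rw [Nat.succPNat_coe]; omega, k, hk, rfl, ht⟩

/-- If the total rate of the clocks after `j` branchings is `c * (s + j)`, then the rescaled number
of branchings converges almost surely, and the limit has a gamma distribution of shape `s`. -/
theorem exists_tendsto_branching {Ω : Type*} [MeasurableSpace Ω] {P : Measure Ω}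
    {b : ℕ → ℝ} (hb : ∀ i, 0 < b i) {m : ℕ} (hm : 0 < m) {c s : ℝ} (hc : 0 < c) (hs : 0 < s)
    (hrate : ∀ j : ℕ, ∑ i ∈ Finset.range (m + j), b i + j = c * (s + j))
    {E : Ω → ℕ × ℕ → ℝ} (hE : HasLaw E (clockMeasure b) P) {T : Ω → ℕ → ℝ}
    (hT : ∀ ω, IsBranching m (E ω) fun n => T ω (n + 1)) :
    ∃ W : Ω → ℝ, HasLaw W (gammaMeasure s 1) P ∧
      ∀ᵐ ω ∂P, Tendsto (fun n : ℕ => (n : ℝ) / Real.exp (c * T ω n)) atTop (𝓝 (W ω)) := by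
  have hgap : HasLaw (gapSeq m) (gapMeasure c s) (clockMeasure b) := by
    refine ⟨(measurable_gapSeq m).aemeasurable, ?_⟩
    rw [map_gapSeq_clockMeasure hb hm, gapMeasure]
    simp only [hrate]
  have hlaw : HasLaw (fun ω => gapSeq m (E ω)) (gapMeasure c s) P := hgap.comp hE
  obtain ⟨W, hW, hlim⟩ := exists_tendsto_gapMeasure hc hs
  refine ⟨fun ω => W (gapSeq m (E ω)), hW.comp hlaw, ?_⟩
  rw [← hlaw.map_eq] at hlim
  have hpos := ae_stepIter_pos hb hm
  rw [← hE.map_eq] at hpos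
  filter_upwards [ae_of_ae_map hlaw.aemeasurable hlim, ae_of_ae_map hE.aemeasurable hpos]
    with ω hω hω'
  -- `T ω (n + 1)` is the sum of `n` gaps, so the shift costs a factor `(n + 1)/n`.
  refine (tendsto_add_atTop_iff_nat 1).1 ?_
  have h := hω.mul (tendsto_natCast_add_div_natCast_add 1 0)
  rw [mul_one] at h
  refine h.congr' ?_
  filter_upwards [eventually_ne_atTop 0] with n hn
  have hn' : (n : ℝ) ≠ 0 := Nat.cast_ne_zero.2 hn
  rw [(hT ω).eq_sum hm hω' n]
  push_cast
  field_simp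
  ring

end BranchingTimes

theorem mainTheorem6 {Ω : Type*} [MeasurableSpace Ω] (P : Measure Ω) [IsProbabilityMeasure P]
    (δ : ℝ) (hδ : -1 < δ) (BI : ℕ+ → ℝ≥0 → Ω → ℕ)
    (hBI_one : BranchingTimes.IsBIProcess P (BI 1) 2 δ)
    (hBI : ∀ i : ℕ+, 2 ≤ i → BranchingTimes.IsBIProcess P (BI i) 1 δ)
    (hindep : iIndepFun (fun (i : ℕ+) (ω : Ω) (t : ℝ≥0) => BI i t ω) P) :
    (∃ W_A : Ω → ℝ, HasLaw W_A (expMeasure 1) P ∧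
      ∀ᵐ ω ∂P, Tendsto
        (fun n : ℕ => (n : ℝ) /
          Real.exp ((2 + δ) * BranchingTimes.branchTimeA (fun i t => BI i t ω) n))
        atTop (𝓝 (W_A ω))) ∧
    (∃ W_B : Ω → ℝ, HasLaw W_B (gammaMeasure ((3 + 2 * δ) / (2 + δ)) 1) P ∧
      ∀ᵐ ω ∂P, Tendsto
        (fun n : ℕ => (n : ℝ) /
          Real.exp ((2 + δ) * BranchingTimes.branchTimeB (fun i t => BI i t ω) n))
        atTop (𝓝 (W_B ω))) := by
  set X : ℕ → ℝ≥0 → Ω → ℕ := fun i => BI i.succPNat with hX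
  set a : ℕ → ℕ := fun i => if i = 0 then 2 else 1 with ha
  have hBIX : ∀ i, BranchingTimes.IsBIProcess P (X i) (a i) δ := by
    rintro (_ | i)
    · exact hBI_one
    · exact hBI _ (by rw [← PNat.coe_le_coe]; simp)
  have hlaw := BranchingTimes.hasLaw_holdingTimes hBIX (hindep.precomp Nat.succPNat_injective)
  have hb : ∀ i, 0 < (a i : ℝ) + δ := fun i => by
    simp only [ha]
    split_ifs <;> push_cast <;> linarith
  have hsum : ∀ n, ∑ i ∈ Finset.range (n + 1), ((a i : ℝ) + δ) = 2 + δ + n * (1 + δ) := fun n => by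
    simp [Finset.sum_range_succ', ha]
    ring
  have hδ' : 0 < 2 + δ := by linarith
  refine ⟨?_, ?_⟩
  -- One founder: the total rate after `j` branchings is `(2 + δ) * (1 + j)`. The shape is `1`, and
  -- `expMeasure 1` is by definition `gammaMeasure 1 1`.
  · exact BranchingTimes.exists_tendsto_branching hb one_pos hδ' one_pos
      (fun j => by rw [add_comm 1 j, hsum]; ring) hlaw
      (fun ω => BranchingTimes.isBranching_branchTimeA fun i t => BI i t ω)
  -- Two founders: the total rate starts at `(2 + δ) + (1 + δ) = 3 + 2δ` and gains `2 + δ` at each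
  -- branching, whence the shape.
  · refine BranchingTimes.exists_tendsto_branching hb two_pos hδ' (div_pos (by linarith) hδ')
      (fun j => ?_) hlaw
      (fun ω => BranchingTimes.isBranching_branchTimeB fun i t => BI i t ω)
    rw [show 2 + j = j + 1 + 1 by ring, hsum, mul_add (2 + δ), mul_div_cancel₀ _ hδ'.ne']
    push_cast
    ring
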